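/- Let $\mathcal{M}_f = (\mathcal{S}, \mathcal{A}, p, p_0, f)$ be an average general-utility Markov decision process (GUMDP): $\mathcal{S}$ and $\mathcal{A}$ are finite state and action spaces, $p(\cdot \mid s,a) \in \Delta(\mathcal{S})$ are the transition probabilities, $p_0 \in \Delta(\mathcal{S})$ is the initial state distribution, and $f : \Delta(\mathcal{S} \times \mathcal{A}) \to \mathbb{R}$ is the objective function, where $\Delta(\mathcal X)$ denotes the set of probability vectors on $\mathcal X$. A stationary policy is a map $\pi : \mathcal{S} \to \Delta(\mathcal{A})$; let $\zeta_\pi$ be the law of the trajectory $T = (S_0, A_0, S_1, A_1, \ldots)$ with $S_0 \sim p_0$, $A_t \sim \pi(\cdot \mid S_t)$ and $S_{t+1} \sim p(\cdot \mid S_t, A_t)$. Let $$d_\pi(s,a) = \lim_{H \to \infty} \frac{1}{H} \sum_{t=0}^{H-1} \mathbb{P}_{\zeta_\pi}(S_t = s, A_t = a), \qquad f_\infty(\pi) = f(d_\pi),$$ and, for $K \geq 1$ independent trajectories $T_k = (S_{k,0}, A_{k,0}, S_{k,1}, A_{k,1}, \ldots) \sim \zeta_\pi$, $k = 1, \ldots,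 K$, $$\hat d_K(s,a) = \frac{1}{K} \sum_{k=1}^{K} \lim_{H \to \infty} \frac{1}{H} \sum_{t=0}^{H-1} \mathbf{1}(S_{k,t} = s, A_{k,t} = a), \qquad f_K(\pi) = \mathbb{E}\big[f(\hat d_K)\big].$$ Suppose that $\mathcal{M}_f$ is unichain, i.e. for every deterministic stationary policy $\delta : \mathcal{S} \to \mathcal{A}$ the Markov chain on $\mathcal{S}$ with transition matrix $P^\delta(s,s') = p(s' \mid s, \delta(s))$ has exactly one recurrent class (a communicating class each of whose states is returned to with probability one), all other states being transient. Suppose also that $f$ is bounded and continuous. Then, for every stationary policy $\pi$ (possibly randomized) and every integer $K \geq 1$, the limits defining $d_\pi$ exist and $d_\pi \in \Delta(\mathcal{S} \times \mathcal{A})$, the limits defining $\hat d_K$ exist and $\hat d_K \in \Delta(\mathcal{S} \times \mathcal{A})$ almost surely, $f(\hat d_K)$ is integrable, and $$f_K(\pi) = f_\infty(\pi).$$ -/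

import Mathlib

open MeasureTheory ProbabilityTheory Filter Topology

noncomputable section

namespace MarkovChain

variable {X : Type*} [MeasurableSpace X] [DiscreteMeasurableSpace X]

/-- The transition kernel with `P x` as the law of the next state when the current state is `x`. -/
def kernel (P : X → PMF X) : Kernel X X where
  toFun x := (P x).toMeasure
  measurable' := Measurable.of_discrete

instance (P : X → PMF X) : IsMarkovKernel (kernel P) :=
  ⟨fun x => inferInstanceAs (IsProbabilityMeasure (P x).toMeasure)⟩

/-- The transition kernel as a function of the history `(x_0, …, x_n)`; only `x_n` matters. -/
def historyKernel (P : X → PMF X) (n : ℕ) : Kernel (Finset.Iic n → X) X :=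
  (kernel P).comap (fun x => x ⟨n, Finset.mem_Iic.2 le_rfl⟩) (measurable_pi_apply _)

instance (P : X → PMF X) (n : ℕ) : IsMarkovKernel (historyKernel P n) :=
  inferInstanceAs (IsMarkovKernel ((kernel P).comap _ _))

/-- The law on `X^ℕ` of the time-homogeneous Markov chain with initial distribution `μ₀` and
transition probabilities `P`. -/
def law (μ₀ : PMF X) (P : X → PMF X) : Measure (ℕ → X) :=
  Kernel.trajMeasure (X := fun _ => X) μ₀.toMeasure (historyKernel P)

instance (μ₀ : PMF X) (P : X → PMF X) : IsProbabilityMeasure (law μ₀ P) :=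
  inferInstanceAs (IsProbabilityMeasure
    (Kernel.trajMeasure (X := fun _ => X) μ₀.toMeasure (historyKernel P)))

/-- A state is recurrent if the chain started there returns to it with probability one. -/
def IsRecurrent (P : X → PMF X) (x : X) : Prop :=
  law (PMF.pure x) P {ω | ∃ n, 1 ≤ n ∧ ω n = x} = 1

end MarkovChain

namespace MarkovChain

variable {X : Type*}

/-- `y` is reachable from `x` (in zero or more steps of positive probability). -/
def Reachable (P : X → PMF X) : X → X → Prop :=
  Relation.ReflTransGen fun x y => 0 < P x y

/-- The communicating class of `x`. -/
def commClass (P : X → PMF X) (x : X) : Set X :=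
  {y | Reachable P x y ∧ Reachable P y x}

/-- A recurrent class is a communicating class all of whose states are recurrent. -/
def IsRecurrentClass [MeasurableSpace X] [DiscreteMeasurableSpace X]
    (P : X → PMF X) (C : Set X) : Prop :=
  (∃ x, C = commClass P x) ∧ ∀ y ∈ C, IsRecurrent P y

end MarkovChain

/-- A general-utility Markov decision process `(S, A, p, p₀, f)` with finite `S` and `A`. -/
structure GUMDP (S A : Type*) [Fintype S] [Fintype A] where
  /-- transition probabilities: `p s a s'` is `p(s' | s, a)` -/
  p : S → A → PMF S
  /-- initial state distribution -/
  p₀ : PMF S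
  /-- objective, a function of state-action occupancies -/
  f : stdSimplex ℝ (S × A) → ℝ

namespace GUMDP

variable {S A : Type*} [Fintype S] [Fintype A] (M : GUMDP S A)

/-- The transition matrix `P^π(s, s') = ∑ₐ π(a | s) p(s' | s, a)` of a stationary policy. -/
def stateStep (π : S → PMF A) (s : S) : PMF S := (π s).bind (M.p s)

/-- The law of `(S, A)` when `S ∼ μ` and `A ∼ π(· | S)`. -/
def withAction (π : S → PMF A) (μ : PMF S) : PMF (S × A) :=
  μ.bind fun s => (π s).map (Prod.mk s)

/-- Unichain: under every deterministic stationary policy `δ : S → A` there is exactly one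
recurrent class (all the other states being transient). -/
def IsUnichain [MeasurableSpace S] [DiscreteMeasurableSpace S] : Prop :=
  ∀ δ : S → A, ∃! C : Set S,
    MarkovChain.IsRecurrentClass (M.stateStep fun s => PMF.pure (δ s)) C

/-- The function `f` on vectors; it is `f` on the simplex and has the dummy value `0` elsewhere. -/
def utility (d : S × A → ℝ) : ℝ :=
  open scoped Classical in
  if h : d ∈ stdSimplex ℝ (S × A) then M.f ⟨d, h⟩ else 0

/-- `(1/H) ∑_{t < H} 1(S_t = s, A_t = a)` along the trajectory `T`. -/
def empFreq (T : ℕ → S × A) (x : S × A) (H : ℕ) : ℝ :=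
  open scoped Classical in
  (1 / (H : ℝ)) * ∑ t ∈ Finset.range H, if T t = x then 1 else 0

/-- The empirical average occupancy of one infinite trajectory. -/
def empOccupancy (T : ℕ → S × A) (x : S × A) : ℝ :=
  limUnder atTop (empFreq T x)

/-- The empirical average occupancy of `K` infinite trajectories. -/
def empOccupancyK {K : ℕ} (T : Fin K → ℕ → S × A) (x : S × A) : ℝ :=
  (1 / (K : ℝ)) * ∑ k, empOccupancy (T k) x

variable [MeasurableSpace S] [DiscreteMeasurableSpace S]
  [MeasurableSpace A] [DiscreteMeasurableSpace A]

/-- The law `ζ_π` of the trajectory `(S_0, A_0, S_1, A_1, …)` under the stationary policy `π`: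
`S_0 ∼ p₀`, `A_t ∼ π(· | S_t)`, `S_{t+1} ∼ p(· | S_t, A_t)`. -/
def trajLaw (π : S → PMF A) : Measure (ℕ → S × A) :=
  MarkovChain.law (withAction π M.p₀) fun x => withAction π (M.p x.1 x.2)

instance (π : S → PMF A) : IsProbabilityMeasure (M.trajLaw π) :=
  inferInstanceAs (IsProbabilityMeasure (MarkovChain.law _ _))

/-- The joint law of `K` independent trajectories. -/
def trialsLaw (π : S → PMF A) (K : ℕ) : Measure (Fin K → ℕ → S × A) :=
  Measure.pi fun _ => M.trajLaw π

/-- `(1/H) ∑_{t < H} ℙ(S_t = s, A_t = a)`. -/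
def meanFreq (π : S → PMF A) (x : S × A) (H : ℕ) : ℝ :=
  (1 / (H : ℝ)) * ∑ t ∈ Finset.range H, (M.trajLaw π).real {T | T t = x}

/-- The average state-action occupancy `d_π`. -/
def occupancy (π : S → PMF A) (x : S × A) : ℝ :=
  limUnder atTop (M.meanFreq π x)

/-- The finite trials objective `f_K(π) = 𝔼[f(d̂)]`, with `d̂` the empirical average occupancy of
`K` independent trajectories. -/
def finiteTrials (K : ℕ) (π : S → PMF A) : ℝ :=
  ∫ T, M.utility (empOccupancyK T) ∂(M.trialsLaw π K)

/-- The infinite trials objective `f_∞(π) = f(d_π)`. -/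
def infiniteTrials (π : S → PMF A) : ℝ :=
  M.utility (M.occupancy π)

end GUMDP

end

/-!
The set of maximizers of a harmonic function on a finite chain is closed, and so is its set of
minimizers. Choosing `δ s` in the support of `π(· | s)` turns a closed set of the state-action chain
under `π` into a closed set of the state chain under the deterministic policy `δ`; every closed set
of a finite chain contains a recurrent class, so in the unichain case any two closed sets of the
state-action chain meet and its harmonic functions are constant. By rank-nullity each
`g : S × A → ℝ` then solves a Poisson equation `g = c + h - P h`. The sum of `g` along a trajectory
thus differs from `n c` by a bounded term and a martingale with bounded increments, which is `o(n)`
almost surely. Hence the empirical occupancy of a trajectory is almost surely the constant vector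
`d_π`, and `f(d̂_K) = f(d_π)` almost surely.
-/

section StrongLaw

lemma eventually_succ_sq_le_mul_sq {a : ℝ} (ha : 1 < a) :
    ∀ᶠ n : ℕ in atTop, (((n + 1) ^ 2 : ℕ) : ℝ) ≤ a * ((n ^ 2 : ℕ) : ℝ) := by
  have hlim : Tendsto (fun n : ℕ => (1 + 1 / (n : ℝ)) ^ 2) atTop (𝓝 1) := by
    simpa using (tendsto_one_div_atTop_nhds_zero_nat.const_add (1 : ℝ)).pow 2
  filter_upwards [hlim.eventually_lt_const ha, eventually_ne_atTop 0] with n hn hn0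
  calc (((n + 1) ^ 2 : ℕ) : ℝ) = (1 + 1 / (n : ℝ)) ^ 2 * ((n ^ 2 : ℕ) : ℝ) := by
        push_cast
        field_simp
    _ ≤ a * ((n ^ 2 : ℕ) : ℝ) := by gcongr

theorem tendsto_div_of_abs_sub_le_of_tendsto_sq {u : ℕ → ℝ} {C l : ℝ}
    (hu : ∀ n, |u (n + 1) - u n| ≤ C)
    (hsq : Tendsto (fun n : ℕ => u (n ^ 2) / (n ^ 2 : ℕ)) atTop (𝓝 l)) :
    Tendsto (fun n : ℕ => u n / n) atTop (𝓝 l) := by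
  -- Adding a linear drift makes `u` monotone, so convergence along the squares is enough.
  have hmono : Monotone fun n : ℕ => u n + n * C := monotone_nat_of_le_succ fun n => by
    have := (abs_le.1 (hu n)).1
    push_cast
    linarith
  have hdrift : ∀ {c : ℕ → ℕ} {l : ℝ}, Tendsto c atTop atTop →
      (Tendsto (fun n => (u (c n) + c n * C) / c n) atTop (𝓝 (l + C)) ↔
        Tendsto (fun n => u (c n) / c n) atTop (𝓝 l)) := fun {c l} hc => by
    rw [← tendsto_add_const_iff C (f := fun n => u (c n) / c n)]
    refine tendsto_congr' ?_
    filter_upwards [hc.eventually_ne_atTop 0] with n hn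
    field_simp
  refine (hdrift tendsto_id).1 (tendsto_div_of_monotone_of_exists_subseq_tendsto_div _ _ hmono
    fun a ha => ⟨fun n => n ^ 2, eventually_succ_sq_le_mul_sq ha, ?_, ?_⟩)
  · exact tendsto_pow_atTop two_ne_zero
  · exact (hdrift (tendsto_pow_atTop two_ne_zero)).2 hsq

variable {Ω : Type*} {mΩ : MeasurableSpace Ω} {μ : Measure Ω}

lemma ae_tendsto_zero_of_summable_integral {Z : ℕ → Ω → ℝ} (hZ : ∀ n, Integrable (Z n) μ)
    (hZ0 : ∀ n ω, 0 ≤ Z n ω) (hsum : Summable fun n => ∫ ω, Z n ω ∂μ) :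
    ∀ᵐ ω ∂μ, Tendsto (fun n => Z n ω) atTop (𝓝 0) := by
  have hnorm : ∀ n, eLpNorm (Z n) 1 μ = ENNReal.ofReal (∫ ω, Z n ω ∂μ) := fun n => by
    rw [eLpNorm_one_eq_lintegral_enorm,
      ofReal_integral_eq_lintegral_ofReal (hZ n) (ae_of_all _ (hZ0 n))]
    exact lintegral_congr fun ω => Real.enorm_of_nonneg (hZ0 n ω)
  filter_upwards [summable_norm_of_tsum_eLpNorm_ne_top le_rfl
    (fun n => (hZ n).aestronglyMeasurable) (by simpa only [hnorm] using hsum.tsum_ofReal_ne_top)]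
    with ω hω
  exact hω.of_norm.tendsto_atTop_zero

lemma integral_add_sq_of_integral_mul_eq_zero {u v : Ω → ℝ} (hu : MemLp u 2 μ) (hv : MemLp v 2 μ)
    (huv : ∫ ω, u ω * v ω ∂μ = 0) :
    ∫ ω, (u ω + v ω) ^ 2 ∂μ = (∫ ω, u ω ^ 2 ∂μ) + ∫ ω, v ω ^ 2 ∂μ := by
  have hmul : Integrable (fun ω => 2 * (u ω * v ω)) μ := (hu.integrable_mul hv).const_mul 2
  simp only [add_sq, mul_assoc]
  refine (integral_add (hu.integrable_sq.add hmul) hv.integrable_sq).trans ?_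
  rw [integral_add' hu.integrable_sq hmul, integral_const_mul, huv, mul_zero, add_zero]

-- Along the squares the second moments of `u n / n` are summable, and bounded increments
-- interpolate between consecutive squares.
theorem ae_tendsto_div_of_integral_sq_le {u : ℕ → Ω → ℝ} {B C : ℝ} (hu : ∀ n, MemLp (u n) 2 μ)
    (hC : ∀ n ω, |u (n + 1) ω - u n ω| ≤ C) (hB : ∀ n, ∫ ω, u n ω ^ 2 ∂μ ≤ n * B) :
    ∀ᵐ ω ∂μ, Tendsto (fun n : ℕ => u n ω / n) atTop (𝓝 0) := by
  have hint : ∀ n : ℕ, Integrable (fun ω => (u (n ^ 2) ω / (n ^ 2 : ℕ)) ^ 2) μ := fun n => by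
    simpa only [div_pow] using (hu (n ^ 2)).integrable_sq.div_const _
  have hle : ∀ n : ℕ, ∫ ω, (u (n ^ 2) ω / (n ^ 2 : ℕ)) ^ 2 ∂μ ≤ 1 / (n : ℝ) ^ 2 * B := fun n => by
    simp only [div_pow, integral_div]
    calc (∫ ω, u (n ^ 2) ω ^ 2 ∂μ) / ((n ^ 2 : ℕ) : ℝ) ^ 2
        ≤ (n ^ 2 : ℕ) * B / ((n ^ 2 : ℕ) : ℝ) ^ 2 := by gcongr; exact hB _
      _ = 1 / (n : ℝ) ^ 2 * B := by
        rcases eq_or_ne n 0 with rfl | hn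
        · simp
        · push_cast
          field_simp
  have hsum : Summable fun n : ℕ => ∫ ω, (u (n ^ 2) ω / (n ^ 2 : ℕ)) ^ 2 ∂μ :=
    .of_nonneg_of_le (fun n => integral_nonneg fun ω => sq_nonneg _) hle
      ((Real.summable_one_div_nat_pow.2 one_lt_two).mul_right B)
  filter_upwards [ae_tendsto_zero_of_summable_integral hint (fun n ω => sq_nonneg _) hsum]
    with ω hω
  refine tendsto_div_of_abs_sub_le_of_tendsto_sq (fun n => hC n ω) ?_
  refine (tendsto_zero_iff_abs_tendsto_zero _).2 ?_
  simpa [Function.comp_def, Real.sqrt_sq_eq_abs] using hω.sqrt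

end StrongLaw

namespace MarkovChain

section ClosedSets

variable {X : Type*} {P : X → PMF X} {x y : X} {D : Set X}

/-- A set of states that the chain cannot leave. -/
def IsClosedSet (P : X → PMF X) (D : Set X) : Prop :=
  ∀ x ∈ D, ∀ y, 0 < P x y → y ∈ D

/-- A chain is indecomposable if it has no two disjoint nonempty closed sets of states. -/
def IsIndecomposable (P : X → PMF X) : Prop :=
  ∀ ⦃D E : Set X⦄, IsClosedSet P D → IsClosedSet P E → D.Nonempty → E.Nonempty →
    (D ∩ E).Nonempty

/-- A state is essential if it can be reached back from every state it leads to. For finite chains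
this is the combinatorial counterpart of recurrence. -/
def IsEssential (P : X → PMF X) (x : X) : Prop :=
  ∀ y, Reachable P x y → Reachable P y x

lemma exists_pos (p : PMF X) : ∃ x, 0 < p x :=
  p.support_nonempty.imp fun x hx => (p.apply_pos_iff x).2 hx

lemma mem_commClass_self (P : X → PMF X) (x : X) : x ∈ commClass P x :=
  ⟨.refl, .refl⟩

lemma IsClosedSet.mem_of_reachable (hD : IsClosedSet P D) (hx : x ∈ D) (hxy : Reachable P x y) :
    y ∈ D := by
  induction hxy with
  | refl => exact hx
  | tail _ hstep ih => exact hD _ ih _ hstep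

lemma IsEssential.of_reachable (hx : IsEssential P x) (hxy : Reachable P x y) :
    IsEssential P y :=
  fun z hyz => (hx z (hxy.trans hyz)).trans hxy

lemma IsClosedSet.exists_isEssential [Finite X] (hD : IsClosedSet P D) (hne : D.Nonempty) :
    ∃ x ∈ D, IsEssential P x := by
  obtain ⟨x, hx, hmin⟩ :=
    exists_minimalFor_of_wellFoundedLT (· ∈ D) (fun x => {z | Reachable P x z}) hne
  exact ⟨x, hx, fun y hxy => hmin (hD.mem_of_reachable hx hxy) (fun _ => hxy.trans)
    Relation.ReflTransGen.refl⟩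

end ClosedSets

section StepMean

variable {X : Type*} [Fintype X] {P : X → PMF X} {x y : X}

/-- The transition operator: `stepMean P h x` is the expectation of `h` one step after `x`. -/
def stepMean (P : X → PMF X) : (X → ℝ) →ₗ[ℝ] X → ℝ :=
  Matrix.mulVecLin (Matrix.of fun x y => (P x y).toReal)

lemma stepMean_apply (P : X → PMF X) (h : X → ℝ) (x : X) :
    stepMean P h x = ∑ y, (P x y).toReal * h y :=
  rfl

lemma integral_toMeasure [MeasurableSpace X] [DiscreteMeasurableSpace X] (P : X → PMF X)
    (h : X → ℝ) (x : X) : ∫ y, h y ∂(P x).toMeasure = stepMean P h x :=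
  PMF.integral_eq_sum _ _

lemma stepMean_const (P : X → PMF X) (c : ℝ) : stepMean P (fun _ => c) = fun _ => c := by
  let _ : MeasurableSpace X := ⊤
  ext x
  simp [← integral_toMeasure]

lemma stepMean_mono (P : X → PMF X) : Monotone (stepMean P) := fun _ _ hgh _ =>
  Finset.sum_le_sum fun y _ => mul_le_mul_of_nonneg_left (hgh y) ENNReal.toReal_nonneg

lemma eq_of_le_stepMean {h : X → ℝ} {m : ℝ} (hle : ∀ z, 0 < P x z → h z ≤ m)
    (hm : m ≤ stepMean P h x) (hy : 0 < P x y) : h y = m := by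
  have hterm : ∀ z ∈ Finset.univ, (P x z).toReal * h z ≤ (P x z).toReal * m := fun z _ => by
    rcases eq_or_ne (P x z) 0 with hz | hz
    · simp [hz]
    · exact mul_le_mul_of_nonneg_left (hle z hz.pos) ENNReal.toReal_nonneg
  have hsum : ∑ z, (P x z).toReal * h z = ∑ z, (P x z).toReal * m := by
    refine (Finset.sum_le_sum hterm).antisymm ?_
    rwa [← stepMean_apply P fun _ => m, ← stepMean_apply P h, stepMean_const]
  exact mul_left_cancel₀ (ENNReal.toReal_pos hy.ne' (PMF.apply_ne_top _ _)).ne'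
    ((Finset.sum_eq_sum_iff_of_le hterm).1 hsum y (Finset.mem_univ y))

lemma isClosedSet_maximizers {h : X → ℝ} (hh : stepMean P h = h) (hx : ∀ z, h z ≤ h x) :
    IsClosedSet P {z | h z = h x} := fun z hz _ hzw =>
  eq_of_le_stepMean (fun w _ => hx w) (by rw [hh, hz]) hzw

theorem IsIndecomposable.eq_of_stepMean_eq (hP : IsIndecomposable P) {h : X → ℝ}
    (hh : stepMean P h = h) (x y : X) : h x = h y := by
  have : Nonempty X := ⟨x⟩
  obtain ⟨u, hu⟩ := Finite.exists_max h
  obtain ⟨v, hv⟩ := Finite.exists_min h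
  have hmin : IsClosedSet P {z | (-h) z = (-h) v} :=
    isClosedSet_maximizers (by rw [map_neg, hh]) fun z => neg_le_neg (hv z)
  obtain ⟨z, hzu, hzv⟩ := hP (isClosedSet_maximizers hh hu) hmin ⟨u, rfl⟩ ⟨v, rfl⟩
  have huv : h u = h v := hzu.symm.trans (neg_injective hzv)
  linarith [hu x, hv x, hu y, hv y]

-- `1 - P` has at most a one-dimensional kernel, and its range misses the constant `1`, as is seen
-- at a minimum of `h`; so the range and the constants together span everything.
theorem IsIndecomposable.exists_poisson (hP : IsIndecomposable P) (g : X → ℝ) :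
    ∃ (c : ℝ) (h : X → ℝ), ∀ x, g x = c + (h x - stepMean P h x) := by
  rcases isEmpty_or_nonempty X with _ | hX
  · exact ⟨0, 0, isEmptyElim⟩
  obtain ⟨x₀⟩ := id hX
  let L : (X → ℝ) →ₗ[ℝ] X → ℝ := LinearMap.id - stepMean P
  have hker : LinearMap.ker L ≤ ℝ ∙ (1 : X → ℝ) := fun h hh => by
    have hharm : stepMean P h = h := (sub_eq_zero.1 (LinearMap.mem_ker.1 hh)).symm
    exact Submodule.mem_span_singleton.2
      ⟨h x₀, funext fun x => by simp [hP.eq_of_stepMean_eq hharm x x₀]⟩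
  have hone : (1 : X → ℝ) ∉ LinearMap.range L := by
    rintro ⟨h, hh⟩
    obtain ⟨x, hx⟩ := Finite.exists_min h
    have hstep : h x - stepMean P h x = 1 := congrFun hh x
    have hle : h x ≤ stepMean P h x := by
      simpa only [stepMean_const] using stepMean_mono P hx x
    linarith
  have htop : LinearMap.range L ⊔ (ℝ ∙ (1 : X → ℝ)) = ⊤ := by
    refine Submodule.eq_top_of_disjoint _ _ ?_
      ((Submodule.disjoint_span_singleton' one_ne_zero).2 hone)
    rw [← L.finrank_range_add_finrank_ker]
    exact Nat.add_le_add_left (Submodule.finrank_mono hker) _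
  obtain ⟨_, ⟨h, rfl⟩, _, hc, hg⟩ := Submodule.mem_sup.1 (htop ▸ Submodule.mem_top (x := g))
  obtain ⟨c, rfl⟩ := Submodule.mem_span_singleton.1 hc
  refine ⟨c, h, fun x => ?_⟩
  rw [← hg]
  simp [L, add_comm]

end StepMean

section MarkovProperty

variable {X : Type*} {n : ℕ} {F : (ℕ → X) → ℝ}

lemma exists_comp_frestrictLe (hF : DependsOn F (Set.Iic n)) :
    ∃ G : (Finset.Iic n → X) → ℝ, F = G ∘ Preorder.frestrictLe n :=
  (Function.factorsThrough_iff F).1 fun _ _ h =>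
    hF fun i hi => congrFun h ⟨i, Finset.mem_Iic.2 hi⟩

variable [MeasurableSpace X] [DiscreteMeasurableSpace X]

lemma law_map_zero (μ₀ : PMF X) (P : X → PMF X) :
    (law μ₀ P).map (fun ω => ω 0) = μ₀.toMeasure := by
  have heval : (fun ω : ℕ → X => ω 0) =
      (fun y : Finset.Iic 0 → X => y ⟨0, by simp⟩) ∘ Preorder.frestrictLe 0 := rfl
  rw [heval, ← Measure.map_map (by fun_prop) (by fun_prop), law, Kernel.trajMeasure,
    Measure.map_comp _ _ (by fun_prop), Kernel.traj_map_frestrictLe, Kernel.partialTraj_self,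
    Measure.id_comp, Measure.map_map (by fun_prop) (by fun_prop)]
  exact Measure.map_id

lemma integral_law_pure_zero (P : X → PMF X) (h : X → ℝ) (x : X) :
    ∫ ω, h (ω 0) ∂(law (PMF.pure x) P) = h x := by
  rw [← integral_map (φ := fun ω : ℕ → X => ω 0) (measurable_pi_apply 0).aemeasurable
    (Measurable.of_discrete.aestronglyMeasurable), law_map_zero, PMF.toMeasure_pure, integral_dirac]

lemma memLp_of_dependsOn [Finite X] (hF : DependsOn F (Set.Iic n)) (p : ENNReal)
    (μ : Measure (ℕ → X)) [IsFiniteMeasure μ] : MemLp F p μ := by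
  obtain ⟨G, rfl⟩ := exists_comp_frestrictLe hF
  exact (MemLp.of_discrete (μ := μ.map (Preorder.frestrictLe n))).comp_of_map (by fun_prop)

lemma integrable_of_dependsOn [Finite X] (hF : DependsOn F (Set.Iic n))
    (μ : Measure (ℕ → X)) [IsFiniteMeasure μ] : Integrable F μ :=
  memLp_one_iff_integrable.1 (memLp_of_dependsOn hF 1 μ)

variable [Fintype X]

theorem integral_mul_succ (μ₀ : PMF X) (P : X → PMF X) (hF : DependsOn F (Set.Iic n))
    (h : X → ℝ) :
    ∫ ω, F ω * h (ω (n + 1)) ∂(law μ₀ P) = ∫ ω, F ω * stepMean P h (ω n) ∂(law μ₀ P) := by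
  obtain ⟨G, rfl⟩ := exists_comp_frestrictLe hF
  have _ : IsProbabilityMeasure ((law μ₀ P).map (Preorder.frestrictLe (π := fun _ => X) n)) :=
    Measure.isProbabilityMeasure_map (by fun_prop)
  calc ∫ ω, G (Preorder.frestrictLe n ω) * h (ω (n + 1)) ∂(law μ₀ P)
      = ∫ z, G z.1 * h z.2 ∂((law μ₀ P).map fun ω => (Preorder.frestrictLe n ω, ω (n + 1))) := by
        rw [integral_map (by fun_prop) (by fun_prop)]
    _ = ∫ z, G z.1 * h z.2
          ∂((law μ₀ P).map (Preorder.frestrictLe n) ⊗ₘ historyKernel P n) := by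
        rw [law, Kernel.map_frestrictLe_trajMeasure_compProd_eq_map_trajMeasure]
    _ = ∫ y, G y * stepMean P h (y ⟨n, Finset.mem_Iic.2 le_rfl⟩)
          ∂(law μ₀ P).map (Preorder.frestrictLe n) := by
        rw [Measure.integral_compProd .of_finite]
        simp only [integral_const_mul, ← integral_toMeasure]
        rfl
    _ = ∫ ω, G (Preorder.frestrictLe n ω) * stepMean P h (ω n) ∂(law μ₀ P) := by
        rw [integral_map (by fun_prop) (by fun_prop)]
        rfl

end MarkovProperty

section Recurrence

variable {X : Type*}

/-- The Feynman–Kac operator: the transition operator with `k` as a weight on the arrival state. -/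
def weightedStepMean [Fintype X] (P : X → PMF X) (k : X → ℝ) : (X → ℝ) →ₗ[ℝ] X → ℝ :=
  stepMean P ∘ₗ LinearMap.mulLeft ℝ k

lemma weightedStepMean_mono [Fintype X] (P : X → PMF X) {k : X → ℝ} (hk : 0 ≤ k) :
    Monotone (weightedStepMean P k) := fun _ _ hgh =>
  stepMean_mono P (mul_le_mul_of_nonneg_left hgh hk)

/-- The substochastic transition operator of the chain killed on arrival at `y`. -/
noncomputable def killedStepMean [Fintype X] (P : X → PMF X) (y : X) : (X → ℝ) →ₗ[ℝ] X → ℝ :=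
  weightedStepMean P (Set.indicator {y}ᶜ 1)

/-- The probability that the chain started at the argument is not in `y` at times `1, …, n`,
expressed through the killed chain. -/
noncomputable def avoidProb [Fintype X] (P : X → PMF X) (y : X) (n : ℕ) : X → ℝ :=
  (killedStepMean P y)^[n] 1

section Avoid

variable [Fintype X] (P : X → PMF X) (y : X)

lemma killedStepMean_mono : Monotone (killedStepMean P y) :=
  weightedStepMean_mono P fun _ => Set.indicator_nonneg (fun _ _ => zero_le_one) _

lemma killedStepMean_le_stepMean {h : X → ℝ} (hh : 0 ≤ h) : killedStepMean P y h ≤ stepMean P h :=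
  stepMean_mono P fun z =>
    mul_le_of_le_one_left (hh z) (Set.indicator_le_self' (fun _ _ => zero_le_one) z)

lemma avoidProb_nonneg (n : ℕ) : 0 ≤ avoidProb P y n :=
  calc (0 : X → ℝ) = (killedStepMean P y)^[n] 0 := (Function.iterate_fixed (map_zero _) n).symm
    _ ≤ avoidProb P y n := (killedStepMean_mono P y).iterate n zero_le_one

lemma avoidProb_antitone : Antitone (avoidProb P y) :=
  (killedStepMean_mono P y).antitone_iterate_of_map_le
    ((killedStepMean_le_stepMean P y zero_le_one).trans_eq (stepMean_const P 1))

lemma exists_tendsto_avoidProb :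
    ∃ q : X → ℝ, 0 ≤ q ∧ killedStepMean P y q = q ∧ Tendsto (avoidProb P y) atTop (𝓝 q) := by
  have hbdd : BddBelow (Set.range (avoidProb P y)) :=
    ⟨0, Set.forall_mem_range.2 (avoidProb_nonneg P y)⟩
  have hlim := tendsto_atTop_ciInf (avoidProb_antitone P y) hbdd
  exact ⟨_, ge_of_tendsto' hlim (avoidProb_nonneg P y), isFixedPt_of_tendsto_iterate hlim
    (LinearMap.continuous_of_finiteDimensional _).continuousAt, hlim⟩

variable {P y}

-- Were the maximum of `q` over the states reachable from `y` positive, its maximizers other than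
-- `y` would form a closed set, from which `y` could not be reached back.
lemma IsEssential.eq_zero_of_killedStepMean_eq (hy : IsEssential P y) {q : X → ℝ} (hq : 0 ≤ q)
    (hfix : killedStepMean P y q = q) : q y = 0 := by
  obtain ⟨x, hyx, hmax⟩ :=
    Set.exists_max_image {z | Reachable P y z} q (Set.toFinite _) ⟨y, .refl⟩
  suffices hx : q x ≤ 0 from ((hmax y .refl).trans hx).antisymm (hq y)
  by_contra! hpos
  let k : X → ℝ := Set.indicator {y}ᶜ 1
  have hstep : ∀ z, Reachable P y z → q z = q x → ∀ w, 0 < P z w →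
      Reachable P y w ∧ w ≠ y ∧ q w = q x := fun z hyz hz w hzw => by
    have hkq : k w * q w = q x := by
      refine eq_of_le_stepMean (h := k * q) (fun v hzv => ?_) (hz ▸ (congrFun hfix z).ge) hzw
      have hkv : k v ≤ 1 := Set.indicator_le_self' (fun _ _ => zero_le_one) v
      exact (mul_le_of_le_one_left (hq v) hkv).trans (hmax v (hyz.tail hzv))
    have hwy : w ≠ y := by
      rintro rfl
      simp [k, hpos.ne] at hkq
    exact ⟨hyz.tail hzw, hwy, by simpa [k, hwy] using hkq⟩
  have hclosed : IsClosedSet P {w | Reachable P y w ∧ w ≠ y ∧ q w = q x} :=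
    fun z ⟨hyz, _, hz⟩ => hstep z hyz hz
  obtain ⟨w, hxw⟩ := exists_pos (P x)
  have hw := hstep x hyx rfl w hxw
  exact (hclosed.mem_of_reachable hw (hy w hw.1)).2.1 rfl

end Avoid

lemma dependsOn_prod_succ (k : X → ℝ) (n : ℕ) :
    DependsOn (fun ω : ℕ → X => ∏ i ∈ Finset.range n, k (ω (i + 1))) (Set.Iic n) :=
  fun _ _ hω => Finset.prod_congr rfl fun i hi => by rw [hω (i + 1) (Finset.mem_range.1 hi)]

variable [MeasurableSpace X] [DiscreteMeasurableSpace X] {P : X → PMF X} {y : X} {D : Set X}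

theorem integral_prod_mul_eq [Fintype X] (μ₀ : PMF X) (P : X → PMF X) (k h : X → ℝ) (n : ℕ) :
    ∫ ω, (∏ i ∈ Finset.range n, k (ω (i + 1))) * h (ω n) ∂(law μ₀ P) =
      ∫ ω, ((weightedStepMean P k)^[n] h) (ω 0) ∂(law μ₀ P) := by
  induction n generalizing h with
  | zero => simp
  | succ n ih =>
    simp only [Finset.prod_range_succ, mul_assoc, Function.iterate_succ_apply]
    exact (integral_mul_succ μ₀ P (dependsOn_prod_succ k n) (k * h)).trans (ih _)

lemma measurableSet_returns (y : X) :
    MeasurableSet {ω : ℕ → X | ∃ n, 1 ≤ n ∧ ω n = y} := by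
  measurability

lemma measureReal_compl_returns_le_avoidProb [Fintype X] (P : X → PMF X) (y : X) (n : ℕ) :
    (law (PMF.pure y) P).real {ω | ∃ n, 1 ≤ n ∧ ω n = y}ᶜ ≤ avoidProb P y n y := by
  let k : X → ℝ := Set.indicator {y}ᶜ 1
  let F : (ℕ → X) → ℝ := fun ω => ∏ i ∈ Finset.range n, k (ω (i + 1))
  have hF : ∀ ω, 0 ≤ F ω := fun ω =>
    Finset.prod_nonneg fun i _ => Set.indicator_nonneg (fun _ _ => zero_le_one) _
  calc (law (PMF.pure y) P).real {ω | ∃ n, 1 ≤ n ∧ ω n = y}ᶜ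
      = ∫ ω, Set.indicator {ω | ∃ n, 1 ≤ n ∧ ω n = y}ᶜ 1 ω ∂(law (PMF.pure y) P) :=
        (integral_indicator_one (measurableSet_returns y).compl).symm
    _ ≤ ∫ ω, F ω ∂(law (PMF.pure y) P) := by
        refine integral_mono_of_nonneg (ae_of_all _ (Set.indicator_nonneg (by simp)))
          (integrable_of_dependsOn (dependsOn_prod_succ k n) _)
          (ae_of_all _ (Set.indicator_le' (fun ω hω => ?_) fun ω _ => hF ω))
        have hk : ∀ i, k (ω (i + 1)) = 1 := fun i =>
          Set.indicator_of_mem (s := {y}ᶜ) (fun hi => hω ⟨i + 1, i.succ_pos, hi⟩) _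
        simp [F, hk]
    _ = ∫ ω, F ω * (1 : X → ℝ) (ω n) ∂(law (PMF.pure y) P) := by simp
    _ = avoidProb P y n y := by
        rw [← integral_law_pure_zero P (avoidProb P y n)]
        exact integral_prod_mul_eq _ P k 1 n

theorem IsEssential.isRecurrent [Finite X] (hy : IsEssential P y) : IsRecurrent P y := by
  have := Fintype.ofFinite X
  obtain ⟨q, hq, hfix, hlim⟩ := exists_tendsto_avoidProb P y
  have hle : (law (PMF.pure y) P).real {ω | ∃ n, 1 ≤ n ∧ ω n = y}ᶜ ≤ q y :=
    ge_of_tendsto' (tendsto_pi_nhds.1 hlim y) (measureReal_compl_returns_le_avoidProb P y)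
  rw [hy.eq_zero_of_killedStepMean_eq hq hfix] at hle
  exact (prob_compl_eq_zero_iff (measurableSet_returns y)).1
    ((measureReal_eq_zero_iff (measure_ne_top _ _)).1 (hle.antisymm measureReal_nonneg))

theorem IsClosedSet.exists_isRecurrentClass [Finite X] (hD : IsClosedSet P D) (hne : D.Nonempty) :
    ∃ x ∈ D, IsRecurrentClass P (commClass P x) := by
  obtain ⟨x, hx, hess⟩ := hD.exists_isEssential hne
  exact ⟨x, hx, ⟨x, rfl⟩, fun y hy => (hess.of_reachable hy.1).isRecurrent⟩

end Recurrence

section Martingale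

variable {X : Type*} [Fintype X]

/-- The sum of the one-step prediction errors of `h` up to time `n`, a martingale. -/
def stepMartingale (P : X → PMF X) (h : X → ℝ) (n : ℕ) (ω : ℕ → X) : ℝ :=
  ∑ t ∈ Finset.range n, (h (ω (t + 1)) - stepMean P h (ω t))

lemma stepMartingale_succ (P : X → PMF X) (h : X → ℝ) (n : ℕ) (ω : ℕ → X) :
    stepMartingale P h (n + 1) ω =
      stepMartingale P h n ω + (h (ω (n + 1)) - stepMean P h (ω n)) :=
  Finset.sum_range_succ _ n

lemma dependsOn_stepMartingale (P : X → PMF X) (h : X → ℝ) (n : ℕ) :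
    DependsOn (stepMartingale P h n) (Set.Iic n) := fun ω ω' hω =>
  Finset.sum_congr rfl fun t ht => by
    have ht := Finset.mem_range.1 ht
    rw [hω (t + 1) ht, hω t ht.le]

lemma sum_eq_add_stepMartingale {P : X → PMF X} {g h : X → ℝ} {c : ℝ}
    (hg : ∀ x, g x = c + (h x - stepMean P h x)) (n : ℕ) (ω : ℕ → X) :
    ∑ t ∈ Finset.range n, g (ω t) = n * c + (h (ω 0) - h (ω n)) + stepMartingale P h n ω := by
  have htel := Finset.sum_range_sub' (fun t => h (ω t)) n
  rw [← htel]
  simp only [stepMartingale, hg, Finset.sum_add_distrib, Finset.sum_sub_distrib, Finset.sum_const,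
    Finset.card_range, nsmul_eq_mul]
  ring

lemma exists_abs_sub_stepMean_le (P : X → PMF X) (h : X → ℝ) :
    ∃ C, ∀ x y, |h y - stepMean P h x| ≤ C := by
  obtain ⟨C, hC⟩ := Finite.bddAbove_range fun z : X × X => |h z.2 - stepMean P h z.1|
  exact ⟨C, fun x y => hC ⟨(x, y), rfl⟩⟩

variable [MeasurableSpace X] [DiscreteMeasurableSpace X]

lemma integral_stepMartingale_mul_sub (μ₀ : PMF X) (P : X → PMF X) (h : X → ℝ) (n : ℕ) :
    ∫ ω, stepMartingale P h n ω * (h (ω (n + 1)) - stepMean P h (ω n)) ∂(law μ₀ P) = 0 := by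
  have hdep := dependsOn_stepMartingale P h n
  have hint : ∀ (g : X → ℝ) (m : ℕ), n ≤ m →
      Integrable (fun ω => stepMartingale P h n ω * g (ω m)) (law μ₀ P) := fun g m hm =>
    integrable_of_dependsOn (n := m) (fun ω ω' hω => by
      rw [hdep fun i hi => hω i (le_trans hi hm), hω m Set.self_mem_Iic]) _
  simp only [mul_sub]
  rw [integral_sub (hint h _ n.le_succ) (hint _ _ le_rfl), integral_mul_succ μ₀ P hdep h, sub_self]

lemma integral_stepMartingale_sq_le (μ₀ : PMF X) {P : X → PMF X} {h : X → ℝ} {C : ℝ}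
    (hC : ∀ x y, |h y - stepMean P h x| ≤ C) (n : ℕ) :
    ∫ ω, stepMartingale P h n ω ^ 2 ∂(law μ₀ P) ≤ n * C ^ 2 := by
  induction n with
  | zero => simp [stepMartingale]
  | succ n ih =>
    let ξ : (ℕ → X) → ℝ := fun ω => h (ω (n + 1)) - stepMean P h (ω n)
    have hM : MemLp (stepMartingale P h n) 2 (law μ₀ P) :=
      memLp_of_dependsOn (dependsOn_stepMartingale P h n) 2 _
    have hξ : MemLp ξ 2 (law μ₀ P) :=
      memLp_of_dependsOn (n := n + 1)
        (fun ω ω' hω => by simp only [ξ, hω (n + 1) Set.self_mem_Iic, hω n n.le_succ]) 2 _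
    have hξC : ∫ ω, ξ ω ^ 2 ∂(law μ₀ P) ≤ C ^ 2 := by
      refine (integral_mono hξ.integrable_sq (integrable_const (C ^ 2)) fun ω =>
        sq_le_sq.2 ((hC _ _).trans (le_abs_self C))).trans_eq (by simp)
    calc ∫ ω, stepMartingale P h (n + 1) ω ^ 2 ∂(law μ₀ P)
        = (∫ ω, stepMartingale P h n ω ^ 2 ∂(law μ₀ P)) + ∫ ω, ξ ω ^ 2 ∂(law μ₀ P) := by
          simp only [stepMartingale_succ]
          exact integral_add_sq_of_integral_mul_eq_zero hM hξ
            (integral_stepMartingale_mul_sub μ₀ P h n)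
      _ ≤ n * C ^ 2 + C ^ 2 := add_le_add ih hξC
      _ = (n + 1 : ℕ) * C ^ 2 := by push_cast; ring

theorem ae_tendsto_stepMartingale_div (μ₀ : PMF X) (P : X → PMF X) (h : X → ℝ) :
    ∀ᵐ ω ∂(law μ₀ P), Tendsto (fun n : ℕ => stepMartingale P h n ω / n) atTop (𝓝 0) := by
  obtain ⟨C, hC⟩ := exists_abs_sub_stepMean_le P h
  refine ae_tendsto_div_of_integral_sq_le (C := C)
    (fun n => memLp_of_dependsOn (dependsOn_stepMartingale P h n) 2 _) (fun n ω => ?_)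
    (integral_stepMartingale_sq_le μ₀ hC)
  simpa only [stepMartingale_succ, add_sub_cancel_left] using hC _ _

end Martingale

theorem IsIndecomposable.exists_ae_tendsto_average {X : Type*} [Finite X] [MeasurableSpace X]
    [DiscreteMeasurableSpace X] {P : X → PMF X} (hP : IsIndecomposable P) (g : X → ℝ) :
    ∃ c, ∀ μ₀, ∀ᵐ ω ∂(law μ₀ P),
      Tendsto (fun n : ℕ => (∑ t ∈ Finset.range n, g (ω t)) / n) atTop (𝓝 c) := by
  have := Fintype.ofFinite X
  obtain ⟨c, h, hg⟩ := hP.exists_poisson g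
  refine ⟨c, fun μ₀ => ?_⟩
  filter_upwards [ae_tendsto_stepMartingale_div μ₀ P h] with ω hω
  have hbdd : Tendsto (fun n : ℕ => (h (ω 0) - h (ω n)) / n) atTop (𝓝 0) := by
    obtain ⟨b, hb⟩ := (Set.finite_range fun x => h (ω 0) - h x).bddBelow
    obtain ⟨B, hB⟩ := (Set.finite_range fun x => h (ω 0) - h x).bddAbove
    exact tendsto_bdd_div_atTop_nhds_zero (.of_forall fun n => hb ⟨ω n, rfl⟩)
      (.of_forall fun n => hB ⟨ω n, rfl⟩) tendsto_natCast_atTop_atTop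
  have hlim : Tendsto (fun n : ℕ => c + (h (ω 0) - h (ω n)) / n + stepMartingale P h n ω / n)
      atTop (𝓝 c) := by
    simpa using (hbdd.const_add c).add hω
  refine hlim.congr' ?_
  filter_upwards [eventually_ne_atTop 0] with n hn
  rw [sum_eq_add_stepMartingale hg]
  field_simp

end MarkovChain

namespace GUMDP

section Policy

variable {S A : Type*} {π : S → PMF A} {μ : PMF S}

lemma withAction_apply_pos_iff {s : S} {a : A} :
    0 < withAction π μ (s, a) ↔ 0 < μ s ∧ 0 < π s a := by
  simp only [PMF.apply_pos_iff, withAction, PMF.mem_support_bind_iff, PMF.support_map,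
    Set.mem_image, Prod.mk.injEq]
  constructor
  · rintro ⟨_, hs, _, ha, rfl, rfl⟩
    exact ⟨hs, ha⟩
  · exact fun ⟨hs, ha⟩ => ⟨s, hs, a, ha, rfl, rfl⟩

variable [Fintype S] [Fintype A] (M : GUMDP S A)

/-- The transition probabilities of the chain `(S_t, A_t)` under a stationary policy. -/
noncomputable def stateActionStep (π : S → PMF A) (x : S × A) : PMF (S × A) :=
  withAction π (M.p x.1 x.2)

variable {M} {δ : S → A} {D : Set (S × A)}

lemma stateStep_pure (δ : S → A) (s : S) : M.stateStep (fun s => PMF.pure (δ s)) s = M.p s (δ s) :=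
  PMF.pure_bind _ _

lemma isClosedSet_stateStep_pure (hδ : ∀ s, 0 < π s (δ s))
    (hD : MarkovChain.IsClosedSet (M.stateActionStep π) D) :
    MarkovChain.IsClosedSet (M.stateStep fun s => PMF.pure (δ s)) {s | (s, δ s) ∈ D} :=
  fun s hs s' hss' =>
    hD (s, δ s) hs (s', δ s')
      (withAction_apply_pos_iff.2 ⟨by rwa [stateStep_pure] at hss', hδ s'⟩)

lemma nonempty_selector_mem (hδ : ∀ s, 0 < π s (δ s))
    (hD : MarkovChain.IsClosedSet (M.stateActionStep π) D) (hne : D.Nonempty) :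
    {s | (s, δ s) ∈ D}.Nonempty := by
  obtain ⟨x, hx⟩ := hne
  obtain ⟨s, hs⟩ := MarkovChain.exists_pos (M.p x.1 x.2)
  exact ⟨s, hD x hx _ (withAction_apply_pos_iff.2 ⟨hs, hδ s⟩)⟩

theorem IsUnichain.isIndecomposable [MeasurableSpace S] [DiscreteMeasurableSpace S]
    (hM : M.IsUnichain) (π : S → PMF A) : MarkovChain.IsIndecomposable (M.stateActionStep π) := by
  intro D E hD hE hDne hEne
  choose δ hδ using fun s => MarkovChain.exists_pos (π s)
  have hclosed := isClosedSet_stateStep_pure hδ hE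
  obtain ⟨x, hxD, hx⟩ :=
    (isClosedSet_stateStep_pure hδ hD).exists_isRecurrentClass (nonempty_selector_mem hδ hD hDne)
  obtain ⟨y, hyE, hy⟩ := hclosed.exists_isRecurrentClass (nonempty_selector_mem hδ hE hEne)
  have hxy := (hM δ).unique hy hx ▸ MarkovChain.mem_commClass_self _ x
  exact ⟨(x, δ x), hxD, hclosed.mem_of_reachable hyE hxy.1⟩

end Policy

section Frequencies

variable {S A : Type*} {T : ℕ → S × A} {x : S × A}

lemma empFreq_eq_sum_indicator_div (T : ℕ → S × A) (x : S × A) (H : ℕ) :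
    empFreq T x H = (∑ t ∈ Finset.range H, Set.indicator {x} 1 (T t)) / H := by
  classical
  simp only [empFreq, div_eq_inv_mul, mul_one, Set.indicator_apply, Set.mem_singleton_iff,
    Pi.one_apply]

lemma empFreq_nonneg (T : ℕ → S × A) (x : S × A) (H : ℕ) : 0 ≤ empFreq T x H := by
  unfold empFreq
  positivity

lemma empFreq_le_one (T : ℕ → S × A) (x : S × A) (H : ℕ) : empFreq T x H ≤ 1 := by
  rw [empFreq_eq_sum_indicator_div]
  refine div_le_one_of_le₀ ?_ H.cast_nonneg
  refine (Finset.sum_le_card_nsmul _ _ 1 fun t _ => ?_).trans_eq (by simp)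
  exact Set.indicator_le_self' (fun _ _ => zero_le_one) _

lemma sum_empFreq [Fintype S] [Fintype A] (T : ℕ → S × A) {H : ℕ} (hH : H ≠ 0) :
    ∑ x, empFreq T x H = 1 := by
  simp only [empFreq]
  rw [← Finset.mul_sum, Finset.sum_comm]
  simp [hH]

lemma mem_stdSimplex_of_tendsto_empFreq [Fintype S] [Fintype A] {d : S × A → ℝ}
    (hd : ∀ x, Tendsto (empFreq T x) atTop (𝓝 (d x))) : d ∈ stdSimplex ℝ (S × A) := by
  refine ⟨fun x => ge_of_tendsto' (hd x) (empFreq_nonneg T x), ?_⟩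
  refine tendsto_nhds_unique (tendsto_finsetSum _ fun x _ => hd x) (tendsto_const_nhds.congr' ?_)
  filter_upwards [eventually_ne_atTop 0] with H hH
  exact (sum_empFreq T hH).symm

lemma empOccupancyK_eq_of_tendsto {K : ℕ} (hK : 1 ≤ K) {T : Fin K → ℕ → S × A}
    {d : S × A → ℝ}
    (hT : ∀ k x, Tendsto (empFreq (T k) x) atTop (𝓝 (d x))) : empOccupancyK T = d := by
  have hlim : ∀ k x, empOccupancy (T k) x = d x := fun k x => (hT k x).limUnder_eq
  have hK0 : (K : ℝ) ≠ 0 := Nat.cast_ne_zero.2 (by omega)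
  ext x
  simp [empOccupancyK, hlim, hK0]

variable [MeasurableSpace S] [DiscreteMeasurableSpace S]
  [MeasurableSpace A] [DiscreteMeasurableSpace A]

lemma measurable_empFreq [Countable S] [Countable A] (x : S × A) (H : ℕ) :
    Measurable fun T : ℕ → S × A => empFreq T x H := by
  simp only [empFreq_eq_sum_indicator_div]
  fun_prop

variable [Fintype S] [Fintype A] {M : GUMDP S A} {π : S → PMF A}

lemma integral_empFreq (M : GUMDP S A) (π : S → PMF A) (x : S × A) (H : ℕ) :
    ∫ T, empFreq T x H ∂(M.trajLaw π) = M.meanFreq π x H := by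
  have hprob : ∀ t, ∫ T, Set.indicator {x} (1 : S × A → ℝ) (T t) ∂(M.trajLaw π) =
      (M.trajLaw π).real {T | T t = x} := fun t =>
    integral_indicator_one (measurable_pi_apply t (measurableSet_singleton x))
  simp only [empFreq_eq_sum_indicator_div, integral_div]
  rw [integral_finsetSum _ fun t _ => MarkovChain.integrable_of_dependsOn (n := t)
    (fun _ _ hT => by rw [hT t Set.self_mem_Iic]) _, meanFreq, one_div_mul_eq_div]
  simp only [hprob]

theorem exists_ae_tendsto_empFreq (hπ : MarkovChain.IsIndecomposable (M.stateActionStep π)) :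
    ∃ d : S × A → ℝ, ∀ᵐ T ∂(M.trajLaw π), ∀ x, Tendsto (empFreq T x) atTop (𝓝 (d x)) := by
  choose d hd using fun x => hπ.exists_ae_tendsto_average (Set.indicator {x} 1)
  refine ⟨d, ae_all_iff.2 fun x => ?_⟩
  filter_upwards [hd x (withAction π M.p₀)] with T hT
  exact hT.congr fun H => (empFreq_eq_sum_indicator_div T x H).symm

lemma tendsto_meanFreq_of_ae {l : ℝ}
    (hl : ∀ᵐ T ∂(M.trajLaw π), Tendsto (empFreq T x) atTop (𝓝 l)) :
    Tendsto (M.meanFreq π x) atTop (𝓝 l) := by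
  have hdom := tendsto_integral_of_dominated_convergence (fun _ => (1 : ℝ))
    (fun H => (measurable_empFreq x H).aestronglyMeasurable) (integrable_const _)
    (fun H => ae_of_all _ fun T => by
      rw [Real.norm_of_nonneg (empFreq_nonneg T x H)]
      exact empFreq_le_one T x H) hl
  simpa only [integral_empFreq, integral_const, probReal_univ, one_smul] using hdom

theorem ae_tendsto_empFreq_occupancy
    (hπ : MarkovChain.IsIndecomposable (M.stateActionStep π)) :
    ∀ᵐ T ∂(M.trajLaw π), ∀ x, Tendsto (empFreq T x) atTop (𝓝 (M.occupancy π x)) := by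
  obtain ⟨d, hd⟩ := exists_ae_tendsto_empFreq hπ
  have hocc : M.occupancy π = d := funext fun x =>
    (tendsto_meanFreq_of_ae (hd.mono fun _ hT => hT x)).limUnder_eq
  rwa [hocc]

theorem occupancy_mem_stdSimplex (hπ : MarkovChain.IsIndecomposable (M.stateActionStep π)) :
    M.occupancy π ∈ stdSimplex ℝ (S × A) :=
  let ⟨_, hT⟩ := (ae_tendsto_empFreq_occupancy hπ).exists
  mem_stdSimplex_of_tendsto_empFreq hT

end Frequencies

section Trials

variable {S A : Type*} [Fintype S] [Fintype A] [MeasurableSpace S] [DiscreteMeasurableSpace S]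
  [MeasurableSpace A] [DiscreteMeasurableSpace A] {M : GUMDP S A} {π : S → PMF A} {K : ℕ}

instance (M : GUMDP S A) (π : S → PMF A) (K : ℕ) : IsProbabilityMeasure (M.trialsLaw π K) :=
  inferInstanceAs (IsProbabilityMeasure (Measure.pi _))

lemma ae_trialsLaw_forall {p : (ℕ → S × A) → Prop} (hp : ∀ᵐ T ∂(M.trajLaw π), p T) :
    ∀ᵐ T ∂(M.trialsLaw π K), ∀ k, p (T k) :=
  ae_all_iff.2 fun _ => Measure.tendsto_eval_ae_ae.eventually hp

end Trials

end GUMDP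

theorem theorem4_general {S A : Type*} [Fintype S] [Fintype A]
    [MeasurableSpace S] [DiscreteMeasurableSpace S]
    [MeasurableSpace A] [DiscreteMeasurableSpace A]
    (M : GUMDP S A) (π : S → PMF A)
    (hπ : MarkovChain.IsIndecomposable (M.stateActionStep π)) (K : ℕ) (hK : 1 ≤ K) :
    (∀ x, ∃ l, Tendsto (M.meanFreq π x) atTop (𝓝 l)) ∧
    M.occupancy π ∈ stdSimplex ℝ (S × A) ∧
    (∀ᵐ T ∂(M.trialsLaw π K), ∀ k x, ∃ l, Tendsto (GUMDP.empFreq (T k) x) atTop (𝓝 l)) ∧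
    (∀ᵐ T ∂(M.trialsLaw π K), GUMDP.empOccupancyK T ∈ stdSimplex ℝ (S × A)) ∧
    Integrable (fun T => M.utility (GUMDP.empOccupancyK T)) (M.trialsLaw π K) ∧
    M.finiteTrials K π = M.infiniteTrials π := by
  have hemp := GUMDP.ae_tendsto_empFreq_occupancy hπ
  have hsimplex := GUMDP.occupancy_mem_stdSimplex hπ
  have hall := GUMDP.ae_trialsLaw_forall (K := K) hemp
  have hocc : ∀ᵐ T ∂(M.trialsLaw π K), GUMDP.empOccupancyK T = M.occupancy π :=
    hall.mono fun T hT => GUMDP.empOccupancyK_eq_of_tendsto hK hT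
  have hutil : (fun T => M.utility (GUMDP.empOccupancyK T)) =ᵐ[M.trialsLaw π K]
      fun _ => M.infiniteTrials π := hocc.mono fun T hT => congrArg M.utility hT
  refine ⟨fun x => ⟨_, GUMDP.tendsto_meanFreq_of_ae (hemp.mono fun _ hT => hT x)⟩, hsimplex,
    hall.mono fun T hT k x => ⟨_, hT k x⟩, hocc.mono fun T hT => hT ▸ hsimplex,
    (integrable_const _).congr hutil.symm, ?_⟩
  rw [GUMDP.finiteTrials, integral_congr_ae hutil, integral_const, probReal_univ, one_smul]

/-- The first four conjuncts say that the limits in the definitions of `d_π` and of the empirical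
occupancy exist (almost surely) and give elements of the domain of `f`; the fifth says that the
expectation exists. -/
theorem theorem4 {S A : Type*} [Fintype S] [Fintype A]
    [MeasurableSpace S] [DiscreteMeasurableSpace S]
    [MeasurableSpace A] [DiscreteMeasurableSpace A]
    (M : GUMDP S A) (hM : M.IsUnichain)
    (hf_cont : Continuous M.f) (hf_bdd : ∃ C : ℝ, ∀ d, |M.f d| ≤ C)
    (π : S → PMF A) (K : ℕ) (hK : 1 ≤ K) :
    (∀ x, ∃ l, Filter.Tendsto (M.meanFreq π x) Filter.atTop (nhds l)) ∧
    M.occupancy π ∈ stdSimplex ℝ (S × A) ∧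
    (∀ᵐ T ∂(M.trialsLaw π K), ∀ k x, ∃ l,
      Filter.Tendsto (GUMDP.empFreq (T k) x) Filter.atTop (nhds l)) ∧
    (∀ᵐ T ∂(M.trialsLaw π K), GUMDP.empOccupancyK T ∈ stdSimplex ℝ (S × A)) ∧
    MeasureTheory.Integrable (fun T => M.utility (GUMDP.empOccupancyK T)) (M.trialsLaw π K) ∧
    M.finiteTrials K π = M.infiniteTrials π :=
  theorem4_general M π (hM.isIndecomposable π) K hK
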